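/- Let $d\ge 2$, $N=2d-2$. Place on the circle $\partial\mathbb D$ the points $s_\ell=\exp(2\pi i\ell/N)$ and the points (ends) $e_\ell=\exp(2\pi i(\ell-\tfrac12)/N)$, $\ell\in\mathbb Z/N$. A relation or involution on $\mathbb Z/N$ is called non-crossing if no two of its pairs of points cross on the circle, unless (for an equivalence relation) the two pairs lie in the same class. A *Branner–Dias data set* $(\sim,H)$ of degree $d$ consists of a non-crossing equivalence relation $\sim$ on $\mathbb Z/N$ and a subset $H\subset\mathbb Z/N$ such that every class meeting $H$ is contained in $H$ and consists of exactly one odd and one even index, and such that every cell of its separatrix disk model is of one of the five types below. In this disk model, for each class $\{k,j\}\subset H$ ($k$ odd, $j$ even) the points $s_k,s_j$ are joined by a curve $s_{k,j}$, a homoclinic separatrix oriented from $s_k$ to $s_j$; for each class outside $H$ all points $s_\ell$ of the class are joined by curves (landing separatrices, incoming to infinity if $\ell$ is even and outgoing if $\ell$ is odd) to one interior point (the equilibrium point of the class); curves of different classes are disjoint. Cells are the connected components of the complement of these curves in the disk. A cell is recorded by the set of ends on its boundary: two ends lie on the boundary of the same cell iff they are not separated on the circle by a pair $s_x,s_y$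 with $x\sim y$. The separatrix $s_\ell$ is adjacent, on its two sides, to $e_\ell$ and $e_{\ell+1}$; the left side of $s_{k,j}$ is the side of $e_k,e_{j+1}$, its right side is that of $e_j,e_{k+1}$. The five types are: * odd (even) center cell: the boundary has no landing separatrix and $n\ge1$ homoclinic separatrices $s_{k_i,j_i}$, all with the cell on the left (right), and the ends of the cell are exactly the $e_{k_i}$ (the $e_{j_i}$); * odd (even) sepal cell: the boundary has exactly one equilibrium point, exactly one incoming and exactly one outgoing landing separatrix, $n\ge0$ homoclinic separatrices, all with the cell on the left (right), and $n+1$ ends, all odd (even); * $\alpha\omega$-cell: the boundary has exactly two equilibrium points $\zeta_\alpha\ne\zeta_\omega$, one or two incoming landing separatrices, all at $\zeta_\alpha$, one or two outgoing ones, all at $\zeta_\omega$, $n_1\ge0$ homoclinic separatrices with the cell on the left, $n_2\ge0$ with the cell on the right, and $n_1+1$ odd and $n_2+1$ even ends. A *combinatorial data set* $(\iota,H,T)$ of degree $d$ consists of a non-crossing involution $\iota$ of $\mathbb Z/N$ and disjoint subsets $H,T$ with $H\cup T=\{\ell:\iota(\ell)\neq\ell\}$ such that, if $\iota(\ell)\ne\ell$,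 then $\ell$ and $\iota(\ell)$ have different parity and are both in $H$ or both in $T$. In its transversal disk model, $s_\ell$ is joined to $s_{\iota(\ell)}$ for $\ell\in H$ and $e_\ell$ to $e_{\iota(\ell)}$ for $\ell\in T$, by disjoint curves. **Proposition.** The two notions are equivalent: there is a bijection $\Phi$ from the Branner–Dias data sets of degree $d$ onto the combinatorial data sets of degree $d$ such that $\Phi(\sim,H)=(\iota,H',T)$ if and only if all of the following hold: 1. $H'=H$, and for $\ell\in H$, $\iota(\ell)$ is the other element of the $\sim$-class of $\ell$; 2. the pairs $\{k,\iota(k)\}$, $k\in T$, are exactly the pairs of distinct indices that, for some $\alpha\omega$-cell, are the indices outside $H$ of the ends on its boundary; 3. the fixed points of $\iota$ are exactly the indices $\ell$ such that, for some sepal cell, $\ell$ is the only index outside $H$ of an end on its boundary; 4. for $\ell,m\notin H$, $\ell\sim m$ if and only if $s_\ell$ and $s_m$ lie on the boundary of the same component of the complement of the curves of the transversal disk model of $(\iota,H',T)$. -/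

import Mathlib

/-! Combinatorics of the disk with `2N` marked points on its boundary circle. In counter-clockwise
order the marked points are `e_0, s_0, e_1, s_1, …, e_{N-1}, s_{N-1}`, where `s_ℓ` is the point
`exp (2πiℓ/N)` and `e_ℓ` is the point `exp (2πi(ℓ-1/2)/N)`, for `ℓ` in `ZMod N`. -/

namespace DiskModel

/-- For points of a circle, listed by their position in counter-clockwise order from some base
point: the points `c` and `d` lie on different open arcs of the circle minus `{a, b}`, i.e. a curve
in the disk from `a` to `b` separates `c` from `d`. -/
def Separates (a b c d : ℕ) : Prop :=
  ((min a b < c ∧ c < max a b) ∧ (d < min a b ∨ max a b < d)) ∨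
  ((min a b < d ∧ d < max a b) ∧ (c < min a b ∨ max a b < c))

/-- The position on the circle of the end `e_ℓ`. -/
def endPos {N : ℕ} (ℓ : ZMod N) : ℕ := 2 * ℓ.val

/-- The position on the circle of the point `s_ℓ`. -/
def sepPos {N : ℕ} (ℓ : ZMod N) : ℕ := 2 * ℓ.val + 1

/-- An index is odd if its representative in `{0, …, N-1}` is odd (used for even `N` only). -/
def IsOdd {N : ℕ} (ℓ : ZMod N) : Prop := Odd ℓ.val

/-- An index is even if its representative in `{0, …, N-1}` is even (used for even `N` only). -/
def IsEven {N : ℕ} (ℓ : ZMod N) : Prop := Even ℓ.val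

/-- Two indices have different parity. -/
def DifferentParity {N : ℕ} (ℓ m : ZMod N) : Prop :=
  (IsOdd ℓ ∧ IsEven m) ∨ (IsEven ℓ ∧ IsOdd m)

/-- An equivalence relation on `ZMod N` is non-crossing: if `a ∼ b` and `c ∼ d` are crossing pairs,
then all four are equivalent. -/
def NonCrossingRel {N : ℕ} (r : Setoid (ZMod N)) : Prop :=
  ∀ a b c d : ZMod N, r a b → r c d → Separates a.val b.val c.val d.val → r a c

/-- An involution on `ZMod N` is non-crossing: no two of the pairs `{a, ι a}` cross. -/
def NonCrossingInvolution {N : ℕ} (ι : ZMod N → ZMod N) : Prop :=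
  ∀ a b : ZMod N, ¬ Separates a.val (ι a).val b.val (ι b).val

/-! ### Separatrix disk models

Let `r` be a non-crossing equivalence relation and `H` a set of indices. In the disk model, the
two points of a class contained in `H` are joined by a curve (a homoclinic separatrix), and the
points `s_ℓ` of a class outside `H` are joined to one interior point (an equilibrium point) by
curves (landing separatrices); curves of different classes are disjoint. -/

section Separatrix

variable {N : ℕ} (r : Setoid (ZMod N)) (H : Set (ZMod N))

/-- The ends `e_a` and `e_b` lie on the boundary of the same connected component of the disk minus
all separatrices, i.e. no two points joined by separatrices separate them. -/
def SameCell (a b : ZMod N) : Prop :=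
  ∀ x y : ZMod N, r x y → ¬ Separates (sepPos x) (sepPos y) (endPos a) (endPos b)

/-- The set `Z` is a cell. A connected component of the disk minus all separatrices is recorded
by the nonempty set of the indices of the ends on its boundary. -/
def IsCell (Z : Set (ZMod N)) : Prop :=
  ∃ a : ZMod N, Z = {b | SameCell r a b}

/-- The landing separatrices on the boundary of the cell `Z`. On its two sides, `s_ℓ` is adjacent to
the ends `e_ℓ` and `e_{ℓ+1}`. -/
def landing (Z : Set (ZMod N)) : Set (ZMod N) :=
  {ℓ | ℓ ∉ H ∧ (ℓ ∈ Z ∨ ℓ + 1 ∈ Z)}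

/-- The incoming (to infinity) landing separatrices on the boundary of `Z`: those of even index. -/
def landingIn (Z : Set (ZMod N)) : Set (ZMod N) :=
  {ℓ | ℓ ∈ landing H Z ∧ IsEven ℓ}

/-- The outgoing (from infinity) landing separatrices on the boundary of `Z`: those of odd index. -/
def landingOut (Z : Set (ZMod N)) : Set (ZMod N) :=
  {ℓ | ℓ ∈ landing H Z ∧ IsOdd ℓ}

/-- The equilibrium points on the boundary of `Z`; an equilibrium point is identified with the class
of the separatrices that land at it. -/
def equilibria (Z : Set (ZMod N)) : Set (Set (ZMod N)) :=
  {C | C ∈ r.classes ∧ (C ∩ landing H Z).Nonempty}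

/-- `(k, j)` are the indices, `k` odd and `j` even, of a homoclinic separatrix `s_{k,j}`. It is
oriented from `s_k` (outgoing from infinity) to `s_j` (incoming to infinity). -/
def IsHomoclinic (k j : ZMod N) : Prop :=
  k ∈ H ∧ j ∈ H ∧ r k j ∧ IsOdd k ∧ IsEven j

/-- The homoclinic separatrices `s_{k,j}` on the boundary of `Z` that have `Z` on their left, which
is the side of the ends `e_k` and `e_{j+1}`. -/
def homLeft (Z : Set (ZMod N)) : Set (ZMod N × ZMod N) :=
  {p | IsHomoclinic r H p.1 p.2 ∧ p.1 ∈ Z ∧ p.2 + 1 ∈ Z}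

/-- The homoclinic separatrices `s_{k,j}` on the boundary of `Z` that have `Z` on their right, which
is the side of the ends `e_j` and `e_{k+1}`. -/
def homRight (Z : Set (ZMod N)) : Set (ZMod N × ZMod N) :=
  {p | IsHomoclinic r H p.1 p.2 ∧ p.2 ∈ Z ∧ p.1 + 1 ∈ Z}

/-- Odd center cell: the boundary consists of homoclinic separatrices `s_{k_i,j_i}`, at least one,
all with the cell on the left; the ends are the `e_{k_i}`. -/
def IsOddCenterCell (Z : Set (ZMod N)) : Prop :=
  landing H Z = ∅ ∧ (homLeft r H Z).Nonempty ∧ homRight r H Z = ∅ ∧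
    Z = Prod.fst '' homLeft r H Z

/-- Even center cell: the boundary consists of homoclinic separatrices `s_{k_i,j_i}`, at least one,
all with the cell on the right; the ends are the `e_{j_i}`. -/
def IsEvenCenterCell (Z : Set (ZMod N)) : Prop :=
  landing H Z = ∅ ∧ homLeft r H Z = ∅ ∧ (homRight r H Z).Nonempty ∧
    Z = Prod.snd '' homRight r H Z

/-- Odd sepal cell: exactly one equilibrium point, one incoming and one outgoing landing separatrix
on the boundary, `n ≥ 0` homoclinic separatrices, all with the cell on the left, and `n + 1` ends,
all odd. -/
def IsOddSepalCell (Z : Set (ZMod N)) : Prop :=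
  (equilibria r H Z).ncard = 1 ∧ (landingIn H Z).ncard = 1 ∧ (landingOut H Z).ncard = 1 ∧
    homRight r H Z = ∅ ∧ (∀ ℓ ∈ Z, IsOdd ℓ) ∧ Z.ncard = (homLeft r H Z).ncard + 1

/-- Even sepal cell: exactly one equilibrium point, one incoming and one outgoing landing separatrix
on the boundary, `n ≥ 0` homoclinic separatrices, all with the cell on the right, and `n + 1` ends,
all even. -/
def IsEvenSepalCell (Z : Set (ZMod N)) : Prop :=
  (equilibria r H Z).ncard = 1 ∧ (landingIn H Z).ncard = 1 ∧ (landingOut H Z).ncard = 1 ∧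
    homLeft r H Z = ∅ ∧ (∀ ℓ ∈ Z, IsEven ℓ) ∧ Z.ncard = (homRight r H Z).ncard + 1

/-- `αω`-cell: exactly two equilibrium points `A` (the `α`-limit, from which all incoming landing
separatrices on the boundary come) and `B` (the `ω`-limit, to which all outgoing ones go), one or
two incoming and one or two outgoing landing separatrices, `n₁ ≥ 0` homoclinic separatrices with the
cell on the left, `n₂ ≥ 0` with the cell on the right, `n₁ + 1` odd ends and `n₂ + 1` even ends. -/
def IsAlphaOmegaCell (Z : Set (ZMod N)) : Prop :=
  (∃ A B : Set (ZMod N), A ≠ B ∧ equilibria r H Z = {A, B} ∧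
    landingIn H Z ⊆ A ∧ landingOut H Z ⊆ B) ∧
  ((landingIn H Z).ncard = 1 ∨ (landingIn H Z).ncard = 2) ∧
  ((landingOut H Z).ncard = 1 ∨ (landingOut H Z).ncard = 2) ∧
  {ℓ | ℓ ∈ Z ∧ IsOdd ℓ}.ncard = (homLeft r H Z).ncard + 1 ∧
  {ℓ | ℓ ∈ Z ∧ IsEven ℓ}.ncard = (homRight r H Z).ncard + 1

end Separatrix

/-- A Branner–Dias combinatorial data set `(∼, H)` on `ZMod N`. -/
structure SeparatrixData (N : ℕ) where
  /-- the equivalence relation `∼` -/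
  rel : Setoid (ZMod N)
  /-- the marked subset -/
  H : Set (ZMod N)
  nonCrossing : NonCrossingRel rel
  homoclinic : ∀ ℓ m : ZMod N, ℓ ≠ m → rel ℓ m → ℓ ∈ H → m ∈ H ∧ DifferentParity ℓ m
  /-- a homoclinic separatrix has two indices -/
  paired : ∀ ℓ ∈ H, ∃ m, m ≠ ℓ ∧ rel ℓ m
  cells : ∀ Z : Set (ZMod N), IsCell rel Z →
    IsAlphaOmegaCell rel H Z ∨ IsOddSepalCell rel H Z ∨ IsEvenSepalCell rel H Z ∨
      IsOddCenterCell rel H Z ∨ IsEvenCenterCell rel H Z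

/-- A combinatorial data set `(ι, H, T)` on `ZMod N`. -/
structure TransversalData (N : ℕ) where
  /-- the involution -/
  ι : ZMod N → ZMod N
  /-- the indices of the paired points `s_ℓ` -/
  H : Set (ZMod N)
  /-- the indices of the paired ends `e_ℓ` -/
  T : Set (ZMod N)
  involutive : Function.Involutive ι
  parity : ∀ ℓ, ι ℓ ≠ ℓ → DifferentParity ℓ (ι ℓ)
  nonCrossing : NonCrossingInvolution ι
  marked : ∀ ℓ, ι ℓ ≠ ℓ → (ℓ ∈ H ∧ ι ℓ ∈ H) ∨ (ℓ ∈ T ∧ ι ℓ ∈ T)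
  /-- `H` and `T` mark only paired indices -/
  paired : ∀ ℓ, ℓ ∈ H ∨ ℓ ∈ T → ι ℓ ≠ ℓ
  /-- no pair is marked twice -/
  disjoint : Disjoint H T

/-- The points `s_ℓ` and `s_m` lie on the boundary of the same connected component of the disk minus
the curves of the transversal disk model of `E`: these curves join `s_x` to `s_{ι x}` for `x ∈ H`
and `e_x` to `e_{ι x}` for `x ∈ T`. -/
def SameTransversalCell {N : ℕ} (E : TransversalData N) (ℓ m : ZMod N) : Prop :=
  (∀ x ∈ E.H, ¬ Separates (sepPos x) (sepPos (E.ι x)) (sepPos ℓ) (sepPos m)) ∧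
  (∀ x ∈ E.T, ¬ Separates (endPos x) (endPos (E.ι x)) (sepPos ℓ) (sepPos m))

/-- The separatrix disk model of `D` and the transversal disk model of `E` correspond. -/
structure Corresponds {N : ℕ} (D : SeparatrixData N) (E : TransversalData N) : Prop where
  /-- the homoclinic separatrices have the same indices … -/
  marked_eq : D.H = E.H
  /-- … and join the same points -/
  homoclinic_iff : ∀ ℓ ∈ D.H, ∀ m, E.ι ℓ = m ↔ D.rel ℓ m ∧ m ≠ ℓ
  /-- the transversals join, for every `αω`-cell, the two ends on its boundary whose indices are
  not indices of homoclinic separatrices -/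
  transversal_iff : ∀ k j : ZMod N, (k ∈ E.T ∧ E.ι k = j) ↔
    k ≠ j ∧ ∃ Z, IsCell D.rel Z ∧ IsAlphaOmegaCell D.rel D.H Z ∧ Z \ D.H = {k, j}
  /-- the unpaired indices are, for every sepal cell, the index of the end on its boundary that is
  not the index of a homoclinic separatrix -/
  unpaired_iff : ∀ ℓ : ZMod N, E.ι ℓ = ℓ ↔
    ∃ Z, IsCell D.rel Z ∧ (IsOddSepalCell D.rel D.H Z ∨ IsEvenSepalCell D.rel D.H Z) ∧
      Z \ D.H = {ℓ}
  /-- landing separatrices land at the same equilibrium point if and only if they are on the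
  boundary of the same component of the transversal disk model -/
  landing_iff : ∀ ℓ m : ZMod N, ℓ ∉ D.H → m ∉ D.H → (D.rel ℓ m ↔ SameTransversalCell E ℓ m)

end DiskModel

set_option linter.unusedSectionVars false

namespace DiskModel

/-! ### Cyclic positions and separation on the circle -/

variable {N : ℕ} [NeZero N]

/-! Both disk models carry the same homoclinic separatrices; what has to be matched is the landing
separatrices with the transversals. The link is the set `Z \ H` of unmarked ends of a cell `Z`. Walk
along the boundary of `Z`: after the end `e_z` comes `s_z`, then the curves of its class lead to
`s_w`, the class member for which the arc from `s_w` counter-clockwise to `s_z` is free of the class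
(`IsNext`), and the next end is `e_{w+1}`. Across a homoclinic separatrix `z` and `w` have different
parity, so `z` and `w + 1` have the same one: parity can change only at an equilibrium point. Hence
the type of a cell can be read off `Z \ H`: empty for a center cell, one index for a sepal cell, two
indices of different parity for an `αω`-cell. The counts of ends and homoclinic separatrices in the
definitions say the same.

From separatrices to transversals, an unmarked index is paired with the other element of `Z \ H`, or
with itself if there is none. These pairs do not cross, because distinct cells are separated by a
pair of equivalent indices. From transversals to separatrices, unmarked indices are related when
they bound the same component. The central point is `TransversalData.diff_eq`: each cell then has at
most one pair of unmarked ends, since two innermost-adjacent pairs would leave the points `s`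
between them in one component, and the resulting class would cut the cell.

Each construction satisfies `Corresponds`, and either datum determines the other through
`Corresponds`, so the constructions are mutually inverse. -/

theorem val_sub_cases (x c b : ZMod N) :
    ((x - c).val + (c - b).val = (x - b).val ∨ (x - c).val + (c - b).val = (x - b).val + N) := by
  have h : (x - b).val = ((x - c).val + (c - b).val) % N := by
    rw [← ZMod.val_add]; congr 1; ring
  have h1 := ZMod.val_lt (x - c)
  have h2 := ZMod.val_lt (c - b)
  rcases Nat.lt_or_ge ((x - c).val + (c - b).val) N with h3 | h3
  · rw [Nat.mod_eq_of_lt h3] at h; omega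
  · rw [Nat.mod_eq_sub_mod h3, Nat.mod_eq_of_lt (by omega)] at h; omega

theorem val_sub_inj {x y b : ZMod N} : (x - b).val = (y - b).val ↔ x = y := by
  rw [(ZMod.val_injective N).eq_iff, sub_left_inj]

theorem val_sub_pos {x b : ZMod N} : 0 < (x - b).val ↔ x ≠ b := by
  rw [Nat.pos_iff_ne_zero, Ne, ZMod.val_eq_zero, sub_eq_zero]

theorem val_add_one_sub (x b : ZMod N) :
    ((x + 1 - b).val = (x - b).val + 1 ∧ (x - b).val + 1 < N) ∨
      ((x + 1 - b).val = 0 ∧ (x - b).val + 1 = N) := by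
  have h1 := ZMod.val_lt (x - b)
  have h2 := NeZero.pos N
  have h : (x + 1 - b).val = ((x - b).val + 1) % N := by
    rw [show x + 1 - b = (x - b) + 1 by ring, ZMod.val_add]
    rcases Nat.lt_or_ge 1 N with h3 | h3
    · rw [ZMod.val_one'' (by omega)]
    · obtain rfl : N = 1 := by omega
      simp [Nat.mod_one]
  rcases Nat.lt_or_ge ((x - b).val + 1) N with h3 | h3
  · rw [Nat.mod_eq_of_lt h3] at h; omega
  · right
    have h4 : (x - b).val + 1 = N := by omega
    rw [h4, Nat.mod_self] at h; omega

theorem separates_iff {a b c d : ℕ} : Separates a b c d ↔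
    (((a < c ∧ c < b) ∨ (b < c ∧ c < a)) ∧ ((d < a ∧ d < b) ∨ (a < d ∧ b < d))) ∨
    (((a < d ∧ d < b) ∨ (b < d ∧ d < a)) ∧ ((c < a ∧ c < b) ∨ (a < c ∧ b < c))) := by
  unfold Separates
  rcases le_total a b with h | h
  · rw [min_eq_left h, max_eq_right h]; omega
  · rw [min_eq_right h, max_eq_left h]; omega

theorem Separates.or_of_ne {a b c d e : ℕ} (h : Separates a b c e) (ha : a ≠ d) (hb : b ≠ d) :
    Separates a b c d ∨ Separates a b d e := by
  have hd : d < min a b ∨ max a b < d ∨ (min a b < d ∧ d < max a b) := by omega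
  unfold Separates at h ⊢
  tauto

theorem Separates.swap {a b c d : ℕ} (h : Separates a b c d) (hac : a ≠ c) (had : a ≠ d)
    (hbc : b ≠ c) (hbd : b ≠ d) : Separates c d a b := by
  rw [separates_iff] at h ⊢
  omega

/-- Separation depends only on the cyclic order, so it survives a shift by `t` modulo `M`. Measuring
positions from a chosen marked point then turns the later geometric arguments into linear
inequalities. -/
theorem Separates.rotate {M t : ℕ} {a b c d a' b' c' d' : ℕ}
    (ha : a + t = a' ∨ a + t = a' + M) (hb : b + t = b' ∨ b + t = b' + M)
    (hc : c + t = c' ∨ c + t = c' + M) (hd : d + t = d' ∨ d + t = d' + M)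
    (ha' : a < M ∧ a' < M) (hb' : b < M ∧ b' < M) (hc' : c < M ∧ c' < M) (hd' : d < M ∧ d' < M)
    (h : Separates a b c d) : Separates a' b' c' d' := by
  rw [separates_iff] at h ⊢
  omega

/-- Positions may be measured from any base point. -/
theorem separates_rebase (b x y z w : ZMod N) {i j k l : ℕ} (hi : i < 2) (hj : j < 2) (hk : k < 2)
    (hl : l < 2) :
    Separates (2 * x.val + i) (2 * y.val + j) (2 * z.val + k) (2 * w.val + l) ↔
      Separates (2 * (x - b).val + i) (2 * (y - b).val + j) (2 * (z - b).val + k)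
        (2 * (w - b).val + l) := by
  have key : ∀ u : ZMod N, ((u - b).val + b.val = u.val ∨ (u - b).val + b.val = u.val + N) ∧
      u.val < N ∧ (u - b).val < N := fun u =>
    ⟨by simpa using val_sub_cases u b 0, ZMod.val_lt _, ZMod.val_lt _⟩
  have hb := ZMod.val_lt b
  obtain ⟨x1, x2, x3⟩ := key x
  obtain ⟨y1, y2, y3⟩ := key y
  obtain ⟨z1, z2, z3⟩ := key z
  obtain ⟨w1, w2, w3⟩ := key w
  constructor
  · apply Separates.rotate (M := 2 * N) (t := 2 * (N - b.val)) <;> omega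
  · apply Separates.rotate (M := 2 * N) (t := 2 * b.val) <;> omega

theorem separates_two_mul {a b c d : ℕ} :
    Separates (2 * a + 0) (2 * b + 0) (2 * c + 0) (2 * d + 0) ↔ Separates a b c d := by
  simp only [separates_iff]; omega

theorem separates_val (b x y z w : ZMod N) : Separates x.val y.val z.val w.val ↔
    Separates (x - b).val (y - b).val (z - b).val (w - b).val := by
  rw [← separates_two_mul, ← separates_two_mul (a := (x - b).val)]
  exact separates_rebase b x y z w (by simp) (by simp) (by simp) (by simp)

theorem separates_sep_end (b x y z w : ZMod N) :
    Separates (sepPos x) (sepPos y) (endPos z) (endPos w) ↔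
    Separates (2 * (x - b).val + 1) (2 * (y - b).val + 1) (2 * (z - b).val) (2 * (w - b).val) :=
  separates_rebase b x y z w (i := 1) (j := 1) (k := 0) (l := 0) (by simp) (by simp) (by simp)
    (by simp)

theorem separates_sep_sep (b x y z w : ZMod N) :
    Separates (sepPos x) (sepPos y) (sepPos z) (sepPos w) ↔
    Separates (x - b).val (y - b).val (z - b).val (w - b).val := by
  rw [sepPos, sepPos, sepPos, sepPos, separates_rebase b] <;> simp [separates_iff]

theorem separates_end_sep (b x y z w : ZMod N) :
    Separates (endPos x) (endPos y) (sepPos z) (sepPos w) ↔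
    Separates (2 * (x - b).val) (2 * (y - b).val) (2 * (z - b).val + 1) (2 * (w - b).val + 1) :=
  separates_rebase b x y z w (i := 0) (j := 0) (k := 1) (l := 1) (by simp) (by simp) (by simp)
    (by simp)

theorem isEven_iff_not_isOdd {x : ZMod N} : IsEven x ↔ ¬ IsOdd x := Nat.not_odd_iff_even.symm

theorem isOdd_add_one (hN : Even N) (x : ZMod N) : IsOdd (x + 1) ↔ ¬ IsOdd x := by
  have h := val_add_one_sub x 0
  simp only [sub_zero] at h
  unfold IsOdd
  obtain ⟨k, hk⟩ := hN
  rw [Nat.odd_iff, Nat.odd_iff]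
  omega

theorem differentParity_iff {x y : ZMod N} : DifferentParity x y ↔ (IsOdd x ↔ ¬ IsOdd y) := by
  unfold DifferentParity
  rw [isEven_iff_not_isOdd, isEven_iff_not_isOdd]
  tauto

/-! ### Cells of a non-crossing relation -/

variable {r : Setoid (ZMod N)} {H : Set (ZMod N)}

theorem SameCell.refl (r : Setoid (ZMod N)) (a : ZMod N) : SameCell r a a := by
  intro x y _ h
  rw [separates_iff] at h
  omega

theorem SameCell.symm {a b : ZMod N} (h : SameCell r a b) : SameCell r b a := by
  intro x y hxy hs
  refine h x y hxy ?_
  rw [separates_iff] at hs ⊢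
  omega

theorem SameCell.trans {a b c : ZMod N} (h : SameCell r a b) (h' : SameCell r b c) :
    SameCell r a c := by
  intro x y hxy hs
  rcases hs.or_of_ne (d := endPos b) (by unfold sepPos endPos; omega)
    (by unfold sepPos endPos; omega) with hs | hs
  exacts [h x y hxy hs, h' x y hxy hs]

theorem NonCrossingRel.separates (hr : NonCrossingRel r) (z : ZMod N) {a b c d : ZMod N}
    (hab : r a b) (hcd : r c d)
    (h : Separates (a - z).val (b - z).val (c - z).val (d - z).val) : r a c :=
  hr a b c d hab hcd ((separates_val z a b c d).2 h)

/-- On the arc that runs from `s_w` to `s_z` in counter-clockwise direction there is no further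
point of the class of `s_z` and `s_w`. -/
def IsNext (r : Setoid (ZMod N)) (z w : ZMod N) : Prop :=
  r z w ∧ ∀ x, r z x → (x - z).val ≤ (w - z).val

theorem exists_isNext (r : Setoid (ZMod N)) (z : ZMod N) : ∃ w, IsNext r z w := by
  obtain ⟨w, hw, hmax⟩ := Set.exists_max_image {x | r z x} (fun x => (x - z).val)
    (Set.toFinite _) ⟨z, r.refl z⟩
  exact ⟨w, hw, hmax⟩

/-- The point `s_m` lies in exactly one of the gaps that the class of `l` leaves on the circle. The
first class member met counter-clockwise from `s_m` is `z`, so the gap from `s_w` to `s_z` is the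
one with `s_m`. -/
theorem exists_isNext_not_mem {l m : ZMod N} (h : ¬ r l m) :
    ∃ z w, r l z ∧ IsNext r z w ∧ (w - z).val < (m - z).val := by
  obtain ⟨z, hz, hmin⟩ := Set.exists_min_image {x | r l x} (fun x => (x - m).val)
    (Set.toFinite _) ⟨l, r.refl l⟩
  obtain ⟨w, hw⟩ := exists_isNext r z
  refine ⟨z, w, hz, hw, ?_⟩
  have hlw : r l w := r.trans hz hw.1
  have h1 := hmin w hlw
  have h2 : 0 < (w - m).val := val_sub_pos.2 (by rintro rfl; exact h hlw)
  have h3 : 0 < (z - m).val := val_sub_pos.2 (by rintro rfl; exact h hz)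
  have h4 := val_sub_cases w z m
  have h5 := val_sub_cases m z m
  simp only [sub_self, ZMod.val_zero] at h5
  have := ZMod.val_lt (w - m)
  have := ZMod.val_lt (z - m)
  have := ZMod.val_lt (w - z)
  omega

theorem exists_isNext_right (r : Setoid (ZMod N)) (w : ZMod N) : ∃ z, IsNext r z w := by
  -- Measured from `w + 1`, the index `w` itself comes last, so it is chosen only when its class is
  -- a singleton.
  obtain ⟨z, hz, hmin⟩ := Set.exists_min_image {x | r w x} (fun x => (x - (w + 1)).val)
    (Set.toFinite _) ⟨w, r.refl w⟩
  refine ⟨z, r.symm hz, fun x hx => ?_⟩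
  have h1 := hmin x (r.trans hz hx)
  have h2 := val_sub_cases x z (w + 1)
  have h3 := val_sub_cases w z (w + 1)
  have h4 := val_add_one_sub w (w + 1)
  have := ZMod.val_lt (x - z)
  have := ZMod.val_lt (w - z)
  have := ZMod.val_lt (x - (w + 1))
  have := ZMod.val_lt (z - (w + 1))
  simp only [sub_self, ZMod.val_zero] at h4
  omega

theorem IsNext.unique {z w w' : ZMod N} (h : IsNext r z w) (h' : IsNext r z w') : w = w' :=
  val_sub_inj.1 (le_antisymm (h'.2 w h.1) (h.2 w' h'.1))

/-- One step of the boundary walk. All points of the class of `z` lie on the arc from `s_z` to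
`s_w`, hence on one side of both ends; a pair of another class separating the ends would cross `{z,
w}`. -/
theorem IsNext.sameCell (hr : NonCrossingRel r) {z w : ZMod N} (h : IsNext r z w) :
    SameCell r z (w + 1) := by
  intro x y hxy hs
  rw [separates_sep_end z, separates_iff] at hs
  have hw := val_add_one_sub w z
  simp only [sub_self, ZMod.val_zero] at hs
  by_cases hx : r z x
  · have h1 := h.2 x hx
    have h2 := h.2 y (r.trans hx hxy)
    omega
  · have hy : ¬ r z y := fun hy => hx (r.trans hy (r.symm hxy))
    have hx0 : 0 < (x - z).val := val_sub_pos.2 (by rintro rfl; exact hx (r.refl _))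
    have hy0 : 0 < (y - z).val := val_sub_pos.2 (by rintro rfl; exact hy (r.refl _))
    have hxw : (x - z).val ≠ (w - z).val := fun e => hx (val_sub_inj.1 e ▸ h.1)
    have hyw : (y - z).val ≠ (w - z).val := fun e => hy (val_sub_inj.1 e ▸ h.1)
    apply hx
    apply hr.separates z h.1 hxy
    rw [separates_iff]
    simp only [sub_self, ZMod.val_zero]
    omega

/-- Otherwise the curve from `s_z` to `s_w` would cut `e_x` off from `e_z`. -/
theorem lt_of_sameCell {z w x : ZMod N} (h : r z w) (hx : SameCell r z x) (hne : x ≠ z) :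
    (w - z).val < (x - z).val := by
  have h1 := hx z w h
  rw [separates_sep_end z, separates_iff] at h1
  have h2 := val_sub_pos.2 hne
  simp only [sub_self, ZMod.val_zero] at h1
  omega

theorem not_rel_of_sameCell {z x : ZMod N} (hx : SameCell r z x) (hne : x ≠ z) : ¬ r z x :=
  fun h => lt_irrefl _ (lt_of_sameCell h hx hne)

variable {Z : Set (ZMod N)}

theorem isCell_of (r : Setoid (ZMod N)) (a : ZMod N) : IsCell r {b | SameCell r a b} := ⟨a, rfl⟩

theorem IsCell.sameCell (hZ : IsCell r Z) {a b : ZMod N} (ha : a ∈ Z) (hb : b ∈ Z) :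
    SameCell r a b := by
  obtain ⟨c, rfl⟩ := hZ
  exact ha.symm.trans hb

theorem IsCell.mem (hZ : IsCell r Z) {a b : ZMod N} (ha : a ∈ Z) (hb : SameCell r a b) :
    b ∈ Z := by
  obtain ⟨c, rfl⟩ := hZ
  exact SameCell.trans ha hb

theorem IsCell.eq_of_mem (hZ : IsCell r Z) {a : ZMod N} (ha : a ∈ Z) :
    Z = {b | SameCell r a b} :=
  Set.ext fun _ => ⟨hZ.sameCell ha, hZ.mem ha⟩

/-- The conditions on the classes of a Branner–Dias data set. -/
structure IsHomoclinicPairing (r : Setoid (ZMod N)) (H : Set (ZMod N)) : Prop where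
  nonCrossing : NonCrossingRel r
  homoclinic : ∀ l m : ZMod N, l ≠ m → r l m → l ∈ H → m ∈ H ∧ DifferentParity l m
  paired : ∀ l ∈ H, ∃ m, m ≠ l ∧ r l m

/-! ### Homoclinic separatrices on the boundary of a cell -/

namespace IsHomoclinicPairing

theorem mem_iff (h : IsHomoclinicPairing r H) {a b : ZMod N} (hab : r a b) : a ∈ H ↔ b ∈ H := by
  by_cases e : a = b
  · rw [e]
  · exact ⟨fun ha => (h.homoclinic a b e hab ha).1,
      fun hb => (h.homoclinic b a (Ne.symm e) (r.symm hab) hb).1⟩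

theorem isOdd_iff (h : IsHomoclinicPairing r H) {a b : ZMod N} (hab : r a b) (ha : a ∈ H)
    (hne : b ≠ a) : IsOdd a ↔ ¬ IsOdd b :=
  differentParity_iff.1 (h.homoclinic a b hne.symm hab ha).2

/-- Three distinct indices cannot have pairwise different parity. -/
theorem unique (h : IsHomoclinicPairing r H) {a b c : ZMod N} (ha : a ∈ H) (hb : r a b)
    (hc : r a c) (hba : b ≠ a) (hca : c ≠ a) : b = c := by
  by_contra hbc
  have h1 := h.isOdd_iff hb ha hba
  have h2 := h.isOdd_iff hc ha hca
  have h3 := h.isOdd_iff (r.trans (r.symm hb) hc) ((h.mem_iff hb).1 ha) (Ne.symm hbc)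
  tauto

theorem isNext (h : IsHomoclinicPairing r H) {a b : ZMod N} (ha : a ∈ H) (hb : r a b)
    (hba : b ≠ a) : IsNext r a b := by
  refine ⟨hb, fun x hx => ?_⟩
  by_cases hxa : x = a
  · simp [hxa]
  · rw [h.unique ha hb hx hba hxa]

theorem ne_of_isNext (h : IsHomoclinicPairing r H) {a b : ZMod N} (ha : a ∈ H)
    (hab : IsNext r a b) : b ≠ a := by
  obtain ⟨m, hm, hr⟩ := h.paired a ha
  rw [hab.unique (h.isNext ha hr hm)]
  exact hm

/-- If `e_k` is an end of the cell, the second end `e_{j+1}` on that side of `s_{k,j}` is one as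
well by `IsNext.sameCell`. So homoclinic separatrices on the boundary can be counted by marked ends.
-/
theorem image_homLeft (h : IsHomoclinicPairing r H) (hZ : IsCell r Z) :
    Prod.fst '' homLeft r H Z = {l | l ∈ Z ∧ IsOdd l} ∩ H := by
  ext k
  constructor
  · rintro ⟨⟨k, j⟩, ⟨⟨hk, hj, hkj, ho, he⟩, hkZ, -⟩, rfl⟩
    exact ⟨⟨hkZ, ho⟩, hk⟩
  · rintro ⟨⟨hkZ, ho⟩, hk⟩
    obtain ⟨j, hne, hkj⟩ := h.paired k hk
    have hj : IsEven j := isEven_iff_not_isOdd.2 ((h.isOdd_iff hkj hk hne).1 ho)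
    exact ⟨(k, j), ⟨⟨hk, (h.mem_iff hkj).1 hk, hkj, ho, hj⟩, hkZ,
      hZ.mem hkZ ((h.isNext hk hkj hne).sameCell h.nonCrossing)⟩, rfl⟩

theorem image_homRight (h : IsHomoclinicPairing r H) (hZ : IsCell r Z) :
    Prod.snd '' homRight r H Z = {l | l ∈ Z ∧ IsEven l} ∩ H := by
  ext j
  constructor
  · rintro ⟨⟨k, j⟩, ⟨⟨hk, hj, hkj, ho, he⟩, hjZ, -⟩, rfl⟩
    exact ⟨⟨hjZ, he⟩, hj⟩
  · rintro ⟨⟨hjZ, he⟩, hj⟩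
    obtain ⟨k, hne, hjk⟩ := h.paired j hj
    have hk : IsOdd k := by
      have := h.isOdd_iff hjk hj hne
      rw [isEven_iff_not_isOdd] at he
      tauto
    exact ⟨(k, j), ⟨⟨(h.mem_iff hjk).1 hj, hj, r.symm hjk, hk, he⟩, hjZ,
      hZ.mem hjZ ((h.isNext hj hjk hne).sameCell h.nonCrossing)⟩, rfl⟩

theorem ncard_homLeft (h : IsHomoclinicPairing r H) (hZ : IsCell r Z) :
    (homLeft r H Z).ncard = ({l | l ∈ Z ∧ IsOdd l} ∩ H).ncard := by
  rw [← h.image_homLeft hZ, Set.InjOn.ncard_image]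
  rintro ⟨k, j⟩ ⟨⟨hk, -, hkj, ho, he⟩, -⟩ ⟨k', j'⟩ ⟨⟨-, -, hkj', -, he'⟩, -⟩ rfl
  dsimp only at *
  rw [isEven_iff_not_isOdd] at he he'
  rw [h.unique hk hkj hkj' (by rintro rfl; exact he ho) (by rintro rfl; exact he' ho)]

theorem ncard_homRight (h : IsHomoclinicPairing r H) (hZ : IsCell r Z) :
    (homRight r H Z).ncard = ({l | l ∈ Z ∧ IsEven l} ∩ H).ncard := by
  rw [← h.image_homRight hZ, Set.InjOn.ncard_image]
  rintro ⟨k, j⟩ ⟨⟨-, hj, hkj, ho, he⟩, -⟩ ⟨k', j'⟩ ⟨⟨-, -, hkj', ho', -⟩, -⟩ rfl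
  dsimp only at *
  rw [isEven_iff_not_isOdd] at he
  rw [h.unique hj (r.symm hkj) (r.symm hkj') (by rintro rfl; exact he ho)
    (by rintro rfl; exact he ho')]

end IsHomoclinicPairing

theorem exists_diff_eq_singleton {α : Type*} [Finite α] {A B : Set α}
    (h : A.ncard = (A ∩ B).ncard + 1) : ∃ a, A \ B = {a} := by
  rw [← Set.ncard_eq_one]
  have := Set.ncard_inter_add_ncard_sdiff_eq_ncard A B (Set.toFinite _)
  omega

theorem ncard_eq_of_diff_eq_singleton {α : Type*} [Finite α] {A B : Set α} {a : α}
    (h : A \ B = {a}) : A.ncard = (A ∩ B).ncard + 1 := by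
  rw [← Set.ncard_inter_add_ncard_sdiff_eq_ncard A B (Set.toFinite _), h, Set.ncard_singleton]

namespace IsHomoclinicPairing

/-! ### The ends of a cell that are not indices of homoclinic separatrices -/

theorem diff_of_isAlphaOmegaCell (h : IsHomoclinicPairing r H) (hZ : IsCell r Z)
    (hc : IsAlphaOmegaCell r H Z) : ∃ a b, IsOdd a ∧ ¬ IsOdd b ∧ Z \ H = {a, b} := by
  obtain ⟨-, -, -, ho, he⟩ := hc
  rw [h.ncard_homLeft hZ] at ho
  rw [h.ncard_homRight hZ] at he
  obtain ⟨a, ha⟩ := exists_diff_eq_singleton ho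
  obtain ⟨b, hb⟩ := exists_diff_eq_singleton he
  have hao : a ∈ {l | l ∈ Z ∧ IsOdd l} \ H := by rw [ha]; rfl
  have hbe : b ∈ {l | l ∈ Z ∧ IsEven l} \ H := by rw [hb]; rfl
  refine ⟨a, b, hao.1.2, isEven_iff_not_isOdd.1 hbe.1.2, ?_⟩
  rw [← Set.singleton_union, ← ha, ← hb]
  ext x
  simp only [isEven_iff_not_isOdd, Set.mem_sdiff, Set.mem_union, Set.mem_ofPred_eq]
  tauto

theorem diff_of_isSepalCell (h : IsHomoclinicPairing r H) (hZ : IsCell r Z)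
    (hc : IsOddSepalCell r H Z ∨ IsEvenSepalCell r H Z) : ∃ a, Z \ H = {a} := by
  rcases hc with ⟨-, -, -, -, hp, hn⟩ | ⟨-, -, -, -, hp, hn⟩
  · rw [h.ncard_homLeft hZ, Set.sep_eq_self_iff_mem_true.2 hp] at hn
    exact exists_diff_eq_singleton hn
  · rw [h.ncard_homRight hZ, Set.sep_eq_self_iff_mem_true.2 hp] at hn
    exact exists_diff_eq_singleton hn

theorem diff_of_isCenterCell (h : IsHomoclinicPairing r H) (hZ : IsCell r Z)
    (hc : IsOddCenterCell r H Z ∨ IsEvenCenterCell r H Z) : Z \ H = ∅ := by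
  rw [Set.sdiff_eq_empty]
  rcases hc with ⟨-, -, -, hn⟩ | ⟨-, -, -, hn⟩
  · rw [h.image_homLeft hZ] at hn
    exact hn ▸ Set.inter_subset_right
  · rw [h.image_homRight hZ] at hn
    exact hn ▸ Set.inter_subset_right

/-! ### Recognizing the type of a cell -/

/-- Homoclinic separatrices join consecutive ends of a cell of the same parity. -/
theorem isOdd_iff_of_forall_mem (h : IsHomoclinicPairing r H) (hN : Even N) (hZ : IsCell r Z)
    {u w : ZMod N} (hu : u ∈ Z) (hw : w ∈ Z)
    (hH : ∀ x ∈ Z, (x - u).val < (w - u).val → x ∈ H) : IsOdd u ↔ IsOdd w := by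
  induction hn : (w - u).val using Nat.strong_induction_on generalizing u with
  | _ n ih =>
    by_cases hwu : w = u
    · rw [hwu]
    have hpos := val_sub_pos.2 hwu
    have huH : u ∈ H := hH u hu (by simpa using hpos)
    obtain ⟨v, hv⟩ := exists_isNext r u
    have hvu := h.ne_of_isNext huH hv
    have hv' : v + 1 ∈ Z := hZ.mem hu (hv.sameCell h.nonCrossing)
    have hlt := lt_of_sameCell hv.1 (hZ.sameCell hu hw) hwu
    have h1 := val_add_one_sub v u
    have h2 := val_sub_cases w (v + 1) u
    have hwN := ZMod.val_lt (w - u)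
    have hwN' := ZMod.val_lt (w - (v + 1))
    -- The end `e_w` lies beyond `s_v`, so the walk resumed at `e_{v+1}` stays on a strictly shorter
    -- part of the same arc.
    have key := ih (w - (v + 1)).val (by omega) hv' (fun x hx hxv => by
      apply hH x hx
      have h3 := val_sub_cases x (v + 1) u
      omega) rfl
    rw [← key, isOdd_add_one hN]
    exact h.isOdd_iff hv.1 huH hvu

theorem isOdd_iff_of_diff_subset (h : IsHomoclinicPairing r H) (hN : Even N) (hZ : IsCell r Z)
    {a b : ZMod N} (ha : a ∈ Z) (hb : b ∈ Z) (hd : Z \ H ⊆ {b}) : IsOdd a ↔ IsOdd b := by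
  refine h.isOdd_iff_of_forall_mem hN hZ ha hb fun x hx hlt => ?_
  by_contra hxH
  rw [hd ⟨hx, hxH⟩] at hlt
  exact lt_irrefl _ hlt

theorem exists_isNext_of_mem_landing (h : IsHomoclinicPairing r H) (hZ : IsCell r Z)
    {l : ZMod N} (hl : l ∈ landing H Z) :
    l ∈ Z \ H ∨ ∃ u ∈ Z \ H, IsNext r u l := by
  obtain ⟨hlH, hl | hl⟩ := hl
  · exact Or.inl ⟨hl, hlH⟩
  · obtain ⟨u, hu⟩ := exists_isNext_right r l
    exact Or.inr ⟨u, ⟨hZ.mem hl (hu.sameCell h.nonCrossing).symm,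
      fun huH => hlH ((h.mem_iff hu.1).1 huH)⟩, hu⟩

theorem landing_of_isNext (h : IsHomoclinicPairing r H) (hZ : IsCell r Z)
    {u l : ZMod N} (hu : u ∈ Z \ H) (hul : IsNext r u l) : l ∈ landing H Z :=
  ⟨fun hl => hu.2 ((h.mem_iff hul.1).2 hl), Or.inr (hZ.mem hu.1 (hul.sameCell h.nonCrossing))⟩

theorem equilibria_eq (h : IsHomoclinicPairing r H) (hZ : IsCell r Z) :
    equilibria r H Z = (fun a => {x | r x a}) '' (Z \ H) := by
  ext C
  constructor
  · rintro ⟨⟨a, rfl⟩, l, hla, hl⟩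
    rcases h.exists_isNext_of_mem_landing hZ hl with hl | ⟨u, hu, hul⟩
    · refine ⟨l, hl, Set.ext fun x => ⟨fun hx => r.trans hx hla, fun hx => r.trans hx (r.symm hla)⟩⟩
    · refine ⟨u, hu, Set.ext fun x => ?_⟩
      have hua : r u a := r.trans hul.1 hla
      exact ⟨fun hx => r.trans hx hua, fun hx => r.trans hx (r.symm hua)⟩
  · rintro ⟨a, ha, rfl⟩
    exact ⟨⟨a, rfl⟩, a, r.refl a, ha.2, Or.inl ha.1⟩

theorem isCenterCell (h : IsHomoclinicPairing r H) (hN : Even N) (hZ : IsCell r Z)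
    (hd : Z \ H = ∅) : IsOddCenterCell r H Z ∨ IsEvenCenterCell r H Z := by
  have hland : landing H Z = ∅ := by
    rw [Set.eq_empty_iff_forall_notMem]
    intro l hl
    rcases h.exists_isNext_of_mem_landing hZ hl with hl | ⟨u, hu, -⟩ <;> simp_all
  have hZH : Z ⊆ H := Set.sdiff_eq_empty.1 hd
  have hpar : ∀ a ∈ Z, ∀ b ∈ Z, IsOdd a ↔ IsOdd b := fun a ha b hb =>
    h.isOdd_iff_of_diff_subset hN hZ ha hb (by simp [hd])
  obtain ⟨a, ha⟩ : Z.Nonempty := by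
    obtain ⟨a, rfl⟩ := hZ
    exact ⟨a, SameCell.refl r a⟩
  by_cases hao : IsOdd a
  · left
    have himg : Z = Prod.fst '' homLeft r H Z := by
      rw [h.image_homLeft hZ]
      ext x
      exact ⟨fun hx => ⟨⟨hx, (hpar a ha x hx).1 hao⟩, hZH hx⟩, fun hx => hx.1.1⟩
    refine ⟨hland, ?_, ?_, himg⟩
    · rw [← Set.image_nonempty (f := Prod.fst), ← himg]
      exact ⟨a, ha⟩
    · rw [← Set.image_eq_empty (f := Prod.snd), h.image_homRight hZ,
        Set.eq_empty_iff_forall_notMem]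
      rintro x ⟨⟨hx, he⟩, -⟩
      exact isEven_iff_not_isOdd.1 he ((hpar a ha x hx).1 hao)
  · right
    have himg : Z = Prod.snd '' homRight r H Z := by
      rw [h.image_homRight hZ]
      ext x
      exact ⟨fun hx => ⟨⟨hx, isEven_iff_not_isOdd.2 fun ho => hao ((hpar a ha x hx).2 ho)⟩, hZH hx⟩,
        fun hx => hx.1.1⟩
    refine ⟨hland, ?_, ?_, himg⟩
    · rw [← Set.image_eq_empty (f := Prod.fst), h.image_homLeft hZ,
        Set.eq_empty_iff_forall_notMem]
      rintro x ⟨⟨hx, ho⟩, -⟩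
      exact hao ((hpar a ha x hx).2 ho)
    · rw [← Set.image_nonempty (f := Prod.snd), ← himg]
      exact ⟨a, ha⟩

theorem isSepalCell (h : IsHomoclinicPairing r H) (hN : Even N) (hZ : IsCell r Z) {a : ZMod N}
    (hd : Z \ H = {a}) : IsOddSepalCell r H Z ∨ IsEvenSepalCell r H Z := by
  have ha : a ∈ Z \ H := by rw [hd]; rfl
  have hpar : ∀ x ∈ Z, IsOdd x ↔ IsOdd a := fun x hx =>
    h.isOdd_iff_of_diff_subset hN hZ hx ha.1 hd.subset
  obtain ⟨w, hw⟩ := exists_isNext r a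
  have hland : landing H Z = {a, w} := by
    ext l
    constructor
    · intro hl
      rcases h.exists_isNext_of_mem_landing hZ hl with hl | ⟨u, hu, hul⟩
      · rw [hd] at hl
        exact Or.inl hl
      · rw [hd] at hu
        obtain rfl : u = a := hu
        exact Or.inr (hul.unique hw)
    · rintro (rfl | rfl)
      · exact ⟨ha.2, Or.inl ha.1⟩
      · exact h.landing_of_isNext hZ ha hw
  -- All ends of the cell share one parity, and `w + 1` is one of them. Thus `a` and `w` differ in
  -- parity: one is incoming, the other outgoing.
  have hwp : ¬ IsOdd w ↔ IsOdd a := by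
    rw [← isOdd_add_one hN, hpar _ (hZ.mem ha.1 (hw.sameCell h.nonCrossing))]
  have heq : (equilibria r H Z).ncard = 1 := by
    rw [h.equilibria_eq hZ, hd, Set.image_singleton, Set.ncard_singleton]
  by_cases hao : IsOdd a
  · left
    refine ⟨heq, Set.ncard_eq_one.2 ⟨w, ?_⟩, Set.ncard_eq_one.2 ⟨a, ?_⟩, ?_, fun x hx =>
      (hpar x hx).2 hao, ?_⟩
    · ext x
      simp only [landingIn, hland, isEven_iff_not_isOdd]
      grind
    · ext x
      simp only [landingOut, hland]
      grind
    · rw [← Set.image_eq_empty (f := Prod.snd), h.image_homRight hZ,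
        Set.eq_empty_iff_forall_notMem]
      rintro x ⟨⟨hx, he⟩, -⟩
      exact isEven_iff_not_isOdd.1 he ((hpar x hx).2 hao)
    · rw [h.ncard_homLeft hZ, Set.sep_eq_self_iff_mem_true.2 fun x hx => (hpar x hx).2 hao]
      exact ncard_eq_of_diff_eq_singleton hd
  · right
    have hev : ∀ x ∈ Z, IsEven x := fun x hx =>
      isEven_iff_not_isOdd.2 fun ho => hao ((hpar x hx).1 ho)
    refine ⟨heq, Set.ncard_eq_one.2 ⟨a, ?_⟩, Set.ncard_eq_one.2 ⟨w, ?_⟩, ?_, hev, ?_⟩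
    · ext x
      simp only [landingIn, hland, isEven_iff_not_isOdd]
      grind
    · ext x
      simp only [landingOut, hland]
      grind
    · rw [← Set.image_eq_empty (f := Prod.fst), h.image_homLeft hZ,
        Set.eq_empty_iff_forall_notMem]
      rintro x ⟨⟨hx, ho⟩, -⟩
      exact hao ((hpar x hx).1 ho)
    · rw [h.ncard_homRight hZ, Set.sep_eq_self_iff_mem_true.2 hev]
      exact ncard_eq_of_diff_eq_singleton hd

/-- Past the equilibrium point next to `c`, the walk from `e_{l+1}` to `e_d` meets only homoclinic
separatrices, which preserve parity. -/
theorem isOdd_of_isNext (h : IsHomoclinicPairing r H) (hN : Even N) (hZ : IsCell r Z)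
    {c d l : ZMod N} (hne : c ≠ d) (hd : Z \ H = {c, d}) (hl : IsNext r c l) :
    IsOdd l ↔ ¬ IsOdd d := by
  have hc : c ∈ Z \ H := by rw [hd]; exact Or.inl rfl
  have hd' : d ∈ Z \ H := by rw [hd]; exact Or.inr rfl
  have hl' : l + 1 ∈ Z := hZ.mem hc.1 (hl.sameCell h.nonCrossing)
  have key : IsOdd (l + 1) ↔ IsOdd d := by
    refine h.isOdd_iff_of_forall_mem hN hZ hl' hd'.1 fun x hx hlt => ?_
    by_contra hxH
    have hx' : x ∈ Z \ H := ⟨hx, hxH⟩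
    rw [hd] at hx'
    rcases hx' with rfl | rfl
    · have h1 := lt_of_sameCell hl.1 (hZ.sameCell hc.1 hd'.1) hne.symm
      have h2 := val_add_one_sub l x
      have h3 := val_sub_cases d (l + 1) x
      have h4 := val_sub_cases x (l + 1) x
      have h5 := ZMod.val_lt (d - x)
      have h6 := ZMod.val_lt (d - (l + 1))
      simp only [sub_self, ZMod.val_zero] at h4
      omega
    · exact lt_irrefl _ hlt
  rw [← key, isOdd_add_one hN, not_not]

theorem isAlphaOmegaCell (h : IsHomoclinicPairing r H) (hN : Even N) (hZ : IsCell r Z)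
    {a b : ZMod N} (hao : IsOdd a) (hbe : ¬ IsOdd b) (hd : Z \ H = {a, b}) :
    IsAlphaOmegaCell r H Z := by
  have hne : a ≠ b := by rintro rfl; exact hbe hao
  have ha : a ∈ Z \ H := by rw [hd]; exact Or.inl rfl
  have hb : b ∈ Z \ H := by rw [hd]; exact Or.inr rfl
  obtain ⟨v, hv⟩ := exists_isNext r a
  obtain ⟨w, hw⟩ := exists_isNext r b
  have hvo := h.isOdd_of_isNext hN hZ hne hd hv
  have hwe := h.isOdd_of_isNext hN hZ hne.symm (by rw [hd, Set.pair_comm]) hw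
  have hland : landing H Z = {a, b, v, w} := by
    ext l
    constructor
    · intro hl
      rcases h.exists_isNext_of_mem_landing hZ hl with hl | ⟨u, hu, hul⟩
      · rw [hd] at hl
        rcases hl with rfl | rfl <;> simp
      · rw [hd] at hu
        rcases hu with rfl | rfl
        · simp [hul.unique hv]
        · simp [hul.unique hw]
    · rintro (rfl | rfl | rfl | rfl)
      · exact ⟨ha.2, Or.inl ha.1⟩
      · exact ⟨hb.2, Or.inl hb.1⟩
      · exact h.landing_of_isNext hZ ha hv
      · exact h.landing_of_isNext hZ hb hw
  have hin : landingIn H Z = {b, w} := by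
    ext x
    simp only [landingIn, hland, isEven_iff_not_isOdd]
    grind
  have hout : landingOut H Z = {a, v} := by
    ext x
    simp only [landingOut, hland]
    grind
  have hpair : ∀ x y : ZMod N, ({x, y} : Set (ZMod N)).ncard = 1 ∨
      ({x, y} : Set (ZMod N)).ncard = 2 := by
    intro x y
    by_cases e : x = y
    · left; simp [e]
    · right; exact Set.ncard_pair e
  -- The incoming `b`, `w` share the class of `b`, which is the `α`-limit; the outgoing `a`, `v`
  -- give the `ω`-limit. Coincidences `w = b` or `v = a` account for "one or two".
  refine ⟨⟨{x | r x b}, {x | r x a}, ?_, ?_, ?_, ?_⟩, hin ▸ hpair _ _, hout ▸ hpair _ _, ?_, ?_⟩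
  · intro e
    have : b ∈ {x | r x a} := e ▸ r.refl b
    exact not_rel_of_sameCell (hZ.sameCell hb.1 ha.1) hne this
  · rw [h.equilibria_eq hZ, hd, Set.image_pair, Set.pair_comm]
  · rw [hin]
    rintro x (rfl | rfl)
    exacts [r.refl _, r.symm hw.1]
  · rw [hout]
    rintro x (rfl | rfl)
    exacts [r.refl _, r.symm hv.1]
  · rw [h.ncard_homLeft hZ]
    refine ncard_eq_of_diff_eq_singleton (a := a) ?_
    ext x
    have hx : x ∈ Z ∧ x ∉ H ↔ x = a ∨ x = b := Set.ext_iff.1 hd x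
    clear hd hpair
    simp only [Set.mem_sdiff, Set.mem_ofPred_eq, Set.mem_singleton_iff]
    grind
  · rw [h.ncard_homRight hZ]
    refine ncard_eq_of_diff_eq_singleton (a := b) ?_
    ext x
    have hx : x ∈ Z ∧ x ∉ H ↔ x = a ∨ x = b := Set.ext_iff.1 hd x
    clear hd hpair
    simp only [Set.mem_sdiff, Set.mem_ofPred_eq, Set.mem_singleton_iff, isEven_iff_not_isOdd]
    grind

end IsHomoclinicPairing

/-! ### From the transversal disk model to the separatrix disk model -/

namespace TransversalData

variable (E : TransversalData N)

theorem ι_mem_H {x : ZMod N} (hx : x ∈ E.H) : E.ι x ∈ E.H := by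
  rcases E.marked x (E.paired x (Or.inl hx)) with h | h
  · exact h.2
  · exact absurd h.1 (Set.disjoint_left.1 E.disjoint hx)

theorem ι_mem_H_iff {x : ZMod N} : E.ι x ∈ E.H ↔ x ∈ E.H :=
  ⟨fun h => E.involutive x ▸ E.ι_mem_H h, E.ι_mem_H⟩

theorem mem_T_iff {x : ZMod N} : x ∈ E.T ↔ x ∉ E.H ∧ E.ι x ≠ x := by
  constructor
  · intro hx
    exact ⟨fun h => Set.disjoint_left.1 E.disjoint h hx, E.paired x (Or.inr hx)⟩
  · rintro ⟨hx, hne⟩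
    rcases E.marked x hne with h | h
    · exact absurd h.1 hx
    · exact h.1

theorem not_separates (b x y : ZMod N) :
    ¬ Separates (x - b).val (E.ι x - b).val (y - b).val (E.ι y - b).val := fun h =>
  E.nonCrossing x y ((separates_val b _ _ _ _).2 h)

theorem sameTransversalCell_refl (a : ZMod N) : SameTransversalCell E a a := by
  constructor <;> intro x _ h <;> rw [separates_iff] at h <;> omega

variable {E} in
theorem sameTransversalCell_symm {a b : ZMod N} (h : SameTransversalCell E a b) :
    SameTransversalCell E b a := by
  constructor
  · intro x hx hs
    refine h.1 x hx ?_
    rw [separates_iff] at hs ⊢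
    omega
  · intro x hx hs
    refine h.2 x hx ?_
    rw [separates_iff] at hs ⊢
    omega

theorem val_ne {x y : ZMod N} (h : x ≠ y) : x.val ≠ y.val :=
  fun e => h (ZMod.val_injective N e)

variable {E} in
-- The intermediate point must not be an endpoint of a curve, since such a point is on neither side
-- of it; hence `b ∉ E.H`.
theorem sameTransversalCell_trans {a b c : ZMod N} (hb : b ∉ E.H) (h : SameTransversalCell E a b)
    (h' : SameTransversalCell E b c) : SameTransversalCell E a c := by
  constructor
  · intro x hx hs
    have h3 : x.val ≠ b.val := val_ne (by rintro rfl; exact hb hx)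
    have h4 : (E.ι x).val ≠ b.val := val_ne (by rintro rfl; exact hb (E.ι_mem_H hx))
    rcases hs.or_of_ne (d := sepPos b) (by unfold sepPos; omega) (by unfold sepPos; omega)
      with hs | hs
    exacts [h.1 x hx hs, h'.1 x hx hs]
  · intro x hx hs
    rcases hs.or_of_ne (d := sepPos b) (by unfold sepPos endPos; omega)
      (by unfold sepPos endPos; omega) with hs | hs
    exacts [h.2 x hx hs, h'.2 x hx hs]

/-- The equivalence relation of the separatrix disk model: the homoclinic separatrices join paired
indices, and landing separatrices on the boundary of the same component of the transversal disk
model land at the same point. -/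
def rel : Setoid (ZMod N) where
  r a b := a = b ∨ (a ∈ E.H ∧ E.ι a = b) ∨ (a ∉ E.H ∧ b ∉ E.H ∧ SameTransversalCell E a b)
  iseqv := by
    refine ⟨fun a => Or.inl rfl, ?_, ?_⟩
    · rintro a b (rfl | ⟨h, rfl⟩ | ⟨ha, hb, h⟩)
      · exact Or.inl rfl
      · exact Or.inr (Or.inl ⟨E.ι_mem_H h, E.involutive a⟩)
      · exact Or.inr (Or.inr ⟨hb, ha, sameTransversalCell_symm h⟩)
    · rintro a b c (rfl | ⟨h, rfl⟩ | ⟨ha, hb, h⟩) (rfl | ⟨h', rfl⟩ | ⟨hb', hc, h'⟩)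
      · exact Or.inl rfl
      · exact Or.inr (Or.inl ⟨h', rfl⟩)
      · exact Or.inr (Or.inr ⟨hb', hc, h'⟩)
      · exact Or.inr (Or.inl ⟨h, rfl⟩)
      · exact Or.inl (E.involutive a).symm
      · exact absurd (E.ι_mem_H h) hb'
      · exact Or.inr (Or.inr ⟨ha, hb, h⟩)
      · exact absurd h' hb
      · exact Or.inr (Or.inr ⟨ha, hc, sameTransversalCell_trans hb h h'⟩)

theorem rel_iff {a b : ZMod N} : E.rel a b ↔
    a = b ∨ (a ∈ E.H ∧ E.ι a = b) ∨ (a ∉ E.H ∧ b ∉ E.H ∧ SameTransversalCell E a b) := Iff.rfl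

theorem rel_iff_of_mem {a b : ZMod N} (ha : a ∈ E.H) : E.rel a b ↔ a = b ∨ E.ι a = b := by
  simp [rel_iff, ha]

theorem rel_iff_of_notMem {a b : ZMod N} (ha : a ∉ E.H) (hb : b ∉ E.H) :
    E.rel a b ↔ SameTransversalCell E a b := by
  rw [rel_iff]
  constructor
  · rintro (rfl | ⟨h, -⟩ | ⟨-, -, h⟩)
    exacts [E.sameTransversalCell_refl a, absurd h ha, h]
  · exact fun h => Or.inr (Or.inr ⟨ha, hb, h⟩)

theorem rel_ι {a : ZMod N} (ha : a ∈ E.H) : E.rel a (E.ι a) := Or.inr (Or.inl ⟨ha, rfl⟩)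

theorem nonCrossingRel : NonCrossingRel E.rel := by
  rintro a b c d (rfl | ⟨ha, rfl⟩ | ⟨ha, hb, h⟩) (rfl | ⟨hc, rfl⟩ | ⟨hc, hd, h'⟩) hs
  any_goals
    rw [separates_iff] at hs
    omega
  · exact absurd hs (E.nonCrossing a c)
  · refine absurd ?_ (h'.1 a ha)
    rw [separates_iff] at hs ⊢
    unfold sepPos
    omega
  · refine absurd ?_ (h.1 c hc)
    rw [separates_iff] at hs ⊢
    unfold sepPos
    omega
  -- A curve separating `a` from `c` would leave `a`, `b` on one side and `c`, `d` on the other, but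
  -- then the two pairs could not cross.
  · refine Or.inr (Or.inr ⟨ha, hc, ?_, ?_⟩)
    · intro x hx hx'
      have h1 := h.1 x hx
      have h2 := h'.1 x hx
      have hne : ∀ y, y ∉ E.H → x.val ≠ y.val ∧ (E.ι x).val ≠ y.val := fun y hy =>
        ⟨val_ne (by rintro rfl; exact hy hx), val_ne (by rintro rfl; exact hy (E.ι_mem_H hx))⟩
      have h3 := hne a ha
      have h4 := hne b hb
      have h5 := hne c hc
      have h6 := hne d hd
      rw [separates_iff] at hs hx' h1 h2
      unfold sepPos at *
      omega
    · intro x hx hx'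
      have h1 := h.2 x hx
      have h2 := h'.2 x hx
      rw [separates_iff] at hs hx' h1 h2
      unfold sepPos endPos at *
      omega

theorem isHomoclinicPairing : IsHomoclinicPairing E.rel E.H where
  nonCrossing := E.nonCrossingRel
  homoclinic l m hne h hl := by
    obtain rfl : E.ι l = m := ((E.rel_iff_of_mem hl).1 h).resolve_left hne
    exact ⟨E.ι_mem_H hl, E.parity l (Ne.symm hne)⟩
  paired l hl := ⟨E.ι l, E.paired l (Or.inl hl), E.rel_ι hl⟩

theorem sameCell_ι {a : ZMod N} (ha : a ∉ E.H) : SameCell E.rel a (E.ι a) := by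
  by_cases hne : E.ι a = a
  · rw [hne]
    exact SameCell.refl _ a
  have hιa : E.ι a ∉ E.H := fun h => ha (E.ι_mem_H_iff.1 h)
  rintro x y (rfl | ⟨hx, rfl⟩ | ⟨hx, hy, h⟩) hs
  · rw [separates_iff] at hs
    omega
  · apply E.nonCrossing x a
    have hne : ∀ y, y ∉ E.H → x.val ≠ y.val ∧ (E.ι x).val ≠ y.val := fun y hy =>
      ⟨val_ne (by rintro rfl; exact hy hx), val_ne (by rintro rfl; exact hy (E.ι_mem_H hx))⟩
    have h1 := hne a ha
    have h2 := hne _ hιa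
    rw [separates_iff] at hs ⊢
    unfold sepPos endPos at hs
    omega
  · apply h.2 a (E.mem_T_iff.2 ⟨ha, hne⟩)
    rw [separates_iff] at hs ⊢
    unfold sepPos endPos at hs ⊢
    omega

/-- If a pair of `E` encloses on one side no further unmarked end of its cell, then there is no
further unmarked end on the other side either. -/
theorem false_of_innermost {Z : Set (ZMod N)} (hZ : IsCell E.rel Z) {b c : ZMod N} (hb : b ∈ Z \ E.H)
    (hc : c ∈ Z \ E.H) (hbc : b ≠ c) (hlt : (c - b).val ≤ (E.ι c - b).val)
    (hmin : ∀ x ∈ Z \ E.H, x ≠ b → (x - b).val ≤ (E.ι c - b).val → x = c ∨ x = E.ι c) :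
    False := by
  set d := E.ι c with hd
  have hdH : d ∉ E.H := fun h => hc.2 (E.ι_mem_H_iff.1 h)
  have hdZ : d ∈ Z := hZ.mem hc.1 (E.sameCell_ι hc.2)
  have hcb := val_sub_pos.2 hbc.symm
  have hdb : d ≠ b := by
    rw [← val_sub_pos]
    omega
  have hbd := hZ.sameCell hb.1 hdZ
  -- If `s_b` and `s_d` were equivalent, they would separate the ends `e_b` and `e_d` of the same
  -- cell. So it suffices that no curve of `E` separates `s_b` from `s_d`.
  refine not_rel_of_sameCell hbd hdb ((E.rel_iff_of_notMem hb.2 hdH).2 ⟨?_, ?_⟩)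
  · intro x hx hs
    apply hbd x (E.ι x) (E.rel_ι hx)
    rw [separates_sep_sep b, separates_iff] at hs
    rw [separates_sep_end b, separates_iff]
    simp only [sub_self, ZMod.val_zero] at hs ⊢
    omega
  -- The ends between `s_b` and `s_d` are those at positions in `(0, d - b]`. No transversal has
  -- exactly one endpoint there.
  · have key : ∀ x ∈ E.T, 0 < (x - b).val → (x - b).val ≤ (d - b).val →
        0 < (E.ι x - b).val ∧ (E.ι x - b).val ≤ (d - b).val := by
      intro x hx hx0 hxd
      obtain ⟨hxH, hxι⟩ := E.mem_T_iff.1 hx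
      by_cases hxZ : x ∈ Z
      · rcases hmin x ⟨hxZ, hxH⟩ (val_sub_pos.1 hx0) hxd with e | e
        · rw [e, ← hd]; omega
        · rw [e, E.involutive c]; omega
      -- Some equivalent pair cuts `e_x` off from both `e_b` and `e_d`. It does not separate `e_x`
      -- from its partner, so the partner is trapped on the same arc.
      · have hnot : ¬ SameCell E.rel b x := fun h => hxZ (hZ.mem hb.1 h)
        unfold SameCell at hnot
        push Not at hnot
        obtain ⟨u, v, huv, hs⟩ := hnot
        have h1 := hbd u v huv
        have h2 := E.sameCell_ι hxH u v huv
        rw [separates_sep_end b, separates_iff] at hs h1 h2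
        simp only [sub_self, ZMod.val_zero] at hs h1
        omega
    intro x hx hs
    have hx' : E.ι x ∈ E.T := by
      rw [E.mem_T_iff] at hx ⊢
      rw [E.ι_mem_H_iff, E.involutive x]
      exact ⟨hx.1, hx.2.symm⟩
    have h1 := key x hx
    have h2 := key (E.ι x) hx'
    rw [E.involutive x] at h2
    rw [separates_end_sep b, separates_iff] at hs
    simp only [sub_self, ZMod.val_zero] at hs
    omega

/-- Take the pair that spans the shortest arc. If the cell had a further unmarked end, the nearest
one before that arc would contradict `false_of_innermost`. -/
theorem diff_eq {Z : Set (ZMod N)} (hZ : IsCell E.rel Z) {a : ZMod N} (ha : a ∈ Z \ E.H) :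
    Z \ E.H = {a, E.ι a} := by
  have hι : ∀ x ∈ Z \ E.H, E.ι x ∈ Z \ E.H := fun x hx =>
    ⟨hZ.mem hx.1 (E.sameCell_ι hx.2), fun h => hx.2 (E.ι_mem_H_iff.1 h)⟩
  obtain ⟨c, hc, hmin⟩ := Set.exists_min_image (Z \ E.H) (fun x => (E.ι x - x).val)
    (Set.toFinite _) ⟨a, ha⟩
  -- By non-crossing, the partner of an unmarked end inside the shortest arc is inside too, and the
  -- two would span a shorter arc.
  have hinner : ∀ x ∈ Z \ E.H, (x - c).val ≤ (E.ι c - c).val → x = c ∨ x = E.ι c := by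
    intro x hx hle
    by_contra! hne
    have hx0 := val_sub_pos.2 hne.1
    have hxd : (x - c).val ≠ (E.ι c - c).val := fun e => hne.2 (val_sub_inj.1 e)
    have hs := E.not_separates c c x
    have h1 : (E.ι x - c).val ≠ 0 := by
      have : E.ι x ≠ c := fun e => hne.2 (by rw [← e, E.involutive])
      have := val_sub_pos.2 this
      omega
    have h2 : (E.ι x - c).val ≠ (E.ι c - c).val := fun e =>
      hne.1 (E.involutive.injective (val_sub_inj.1 e))
    rw [separates_iff] at hs
    simp only [sub_self, ZMod.val_zero] at hs
    have h3 := hmin x hx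
    have h4 := hmin _ (hι x hx)
    rw [E.involutive] at h4
    have h5 := val_sub_cases (E.ι x) x c
    have h6 := val_sub_cases x (E.ι x) c
    have h7 := ZMod.val_lt (E.ι x - x)
    have h8 := ZMod.val_lt (x - E.ι x)
    have h9 := ZMod.val_lt (E.ι c - c)
    omega
  have hsub : ∀ x ∈ Z \ E.H, x = c ∨ x = E.ι c := by
    by_contra! hne
    obtain ⟨b₀, hb₀, hb₀c, hb₀d⟩ := hne
    obtain ⟨b, ⟨hb, hbc, hbd⟩, hmax⟩ := Set.exists_max_image
      {x | x ∈ Z \ E.H ∧ x ≠ c ∧ x ≠ E.ι c} (fun x => (x - c).val) (Set.toFinite _)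
      ⟨b₀, hb₀, hb₀c, hb₀d⟩
    have h1 : (E.ι c - c).val < (b - c).val := by
      by_contra! h
      rcases hinner b hb h with h | h
      exacts [hbc h, hbd h]
    have h2 := val_sub_cases (E.ι c) c b
    have h3 := val_sub_cases c b c
    have h4 := ZMod.val_lt (E.ι c - b)
    have h5 := ZMod.val_lt (c - b)
    have h6 := val_sub_pos.2 (Ne.symm hbc)
    have h7 := ZMod.val_lt (b - c)
    have h8 := val_sub_cases (E.ι c) b c
    simp only [sub_self, ZMod.val_zero] at h3
    refine E.false_of_innermost hZ hb hc hbc (by omega) fun x hx hxb hle => ?_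
    by_contra! hne
    have h9 := hmax x ⟨hx, hne.1, hne.2⟩
    have h10 := val_sub_cases x b c
    have h11 := val_sub_pos.2 hxb
    have h12 := mt (hinner x hx) (by tauto)
    have h13 := ZMod.val_lt (x - b)
    have h14 := ZMod.val_lt (x - c)
    omega
  have hac := hsub a ha
  have hιa := E.involutive c
  have hιc := hι c hc
  ext x
  constructor
  · intro hx
    have := hsub x hx
    simp only [Set.mem_insert_iff, Set.mem_singleton_iff]
    grind
  · rintro (rfl | rfl)
    exacts [ha, hι a ha]

theorem cell_type (hN : Even N) (Z : Set (ZMod N)) (hZ : IsCell E.rel Z) :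
    IsAlphaOmegaCell E.rel E.H Z ∨ IsOddSepalCell E.rel E.H Z ∨ IsEvenSepalCell E.rel E.H Z ∨
      IsOddCenterCell E.rel E.H Z ∨ IsEvenCenterCell E.rel E.H Z := by
  have h := E.isHomoclinicPairing
  rcases (Z \ E.H).eq_empty_or_nonempty with hd | ⟨a, ha⟩
  · have := h.isCenterCell hN hZ hd
    tauto
  · have hd := E.diff_eq hZ ha
    by_cases hne : E.ι a = a
    · rw [hne, Set.pair_eq_singleton] at hd
      have := h.isSepalCell hN hZ hd
      tauto
    · left
      have hp := differentParity_iff.1 (E.parity a hne)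
      by_cases hao : IsOdd a
      · exact h.isAlphaOmegaCell hN hZ hao (hp.1 hao) hd
      · rw [Set.pair_comm] at hd
        exact h.isAlphaOmegaCell hN hZ (by tauto) hao hd

/-- The separatrix disk model that corresponds to a transversal disk model. -/
def toSeparatrixData (hN : Even N) : SeparatrixData N where
  rel := E.rel
  H := E.H
  nonCrossing := E.nonCrossingRel
  homoclinic := E.isHomoclinicPairing.homoclinic
  paired := E.isHomoclinicPairing.paired
  cells := E.cell_type hN

theorem corresponds_toSeparatrixData (hN : Even N) : Corresponds (E.toSeparatrixData hN) E where
  marked_eq := rfl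
  homoclinic_iff l hl m := by
    change l ∈ E.H at hl
    change _ ↔ E.rel l m ∧ _
    rw [E.rel_iff_of_mem hl]
    have := E.paired l (Or.inl hl)
    grind
  transversal_iff k j := by
    constructor
    · rintro ⟨hk, rfl⟩
      obtain ⟨hkH, hne⟩ := E.mem_T_iff.1 hk
      have hd := E.diff_eq (isCell_of E.rel k) ⟨SameCell.refl _ k, hkH⟩
      refine ⟨hne.symm, _, isCell_of E.rel k, ?_, hd⟩
      have h := E.isHomoclinicPairing
      have hp := differentParity_iff.1 (E.parity k hne)
      by_cases hko : IsOdd k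
      · exact h.isAlphaOmegaCell hN (isCell_of E.rel k) hko (hp.1 hko) hd
      · rw [Set.pair_comm] at hd
        exact h.isAlphaOmegaCell hN (isCell_of E.rel k) (by tauto) hko hd
    · rintro ⟨hne, Z, hZ, -, hd⟩
      change Z \ E.H = _ at hd
      have hk : k ∈ Z \ E.H := by rw [hd]; exact Or.inl rfl
      have hj : j ∈ Z \ E.H := by rw [hd]; exact Or.inr rfl
      rw [E.diff_eq hZ hk] at hj
      obtain rfl : j = E.ι k := hj.resolve_left hne.symm
      exact ⟨E.mem_T_iff.2 ⟨hk.2, hne.symm⟩, rfl⟩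
  unpaired_iff l := by
    constructor
    · intro hl
      have hlH : l ∉ E.H := fun h => E.paired l (Or.inl h) hl
      have hd := E.diff_eq (isCell_of E.rel l) ⟨SameCell.refl _ l, hlH⟩
      rw [hl, Set.pair_eq_singleton] at hd
      exact ⟨_, isCell_of E.rel l, E.isHomoclinicPairing.isSepalCell hN (isCell_of E.rel l) hd, hd⟩
    · rintro ⟨Z, hZ, -, hd⟩
      change Z \ E.H = _ at hd
      have hl : l ∈ Z \ E.H := by rw [hd]; rfl
      rw [E.diff_eq hZ hl] at hd
      exact hd.subset (Or.inr rfl)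
  landing_iff l m hl hm := E.rel_iff_of_notMem hl hm

end TransversalData

/-! ### From the separatrix disk model to the transversal disk model -/

namespace SeparatrixData

variable (D : SeparatrixData N)

theorem isHomoclinicPairing : IsHomoclinicPairing D.rel D.H where
  nonCrossing := D.nonCrossing
  homoclinic := D.homoclinic
  paired := D.paired

/-- The cell of an unmarked end is not a center cell. For a sepal cell `b = a`; for an `αω`-cell `b`
is the other unmarked end, of the opposite parity. -/
theorem exists_diff_eq {a : ZMod N} (ha : a ∉ D.H) : ∃ b,
    {x | SameCell D.rel a x} \ D.H = {a, b} ∧ (b ≠ a → DifferentParity a b) := by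
  have h := D.isHomoclinicPairing
  have hZ := isCell_of D.rel a
  have haZ : a ∈ {x | SameCell D.rel a x} \ D.H := ⟨SameCell.refl _ a, ha⟩
  obtain hc | hc | hc : IsAlphaOmegaCell D.rel D.H {x | SameCell D.rel a x} ∨
      (IsOddSepalCell D.rel D.H {x | SameCell D.rel a x} ∨
        IsEvenSepalCell D.rel D.H {x | SameCell D.rel a x}) ∨
      (IsOddCenterCell D.rel D.H {x | SameCell D.rel a x} ∨
        IsEvenCenterCell D.rel D.H {x | SameCell D.rel a x}) := by
    have := D.cells _ hZ
    tauto
  · obtain ⟨c, d, hco, hde, hd⟩ := h.diff_of_isAlphaOmegaCell hZ hc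
    have haZ' := haZ
    rw [hd] at haZ'
    rcases haZ' with rfl | rfl
    · exact ⟨d, hd, fun _ => differentParity_iff.2 (by tauto)⟩
    · exact ⟨c, by rw [hd, Set.pair_comm], fun _ => differentParity_iff.2 (by tauto)⟩
  · obtain ⟨c, hd⟩ := h.diff_of_isSepalCell hZ hc
    have haZ' := haZ
    rw [hd] at haZ'
    obtain rfl : a = c := haZ'
    exact ⟨a, by rw [hd, Set.pair_eq_singleton], fun hne => absurd rfl hne⟩
  · rw [h.diff_of_isCenterCell hZ hc] at haZ
    exact absurd haZ (Set.notMem_empty _)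

theorem exists_partner (a : ZMod N) : ∃ b, (a ∈ D.H → D.rel a b ∧ b ≠ a) ∧
    (a ∉ D.H → {x | SameCell D.rel a x} \ D.H = {a, b} ∧ (b ≠ a → DifferentParity a b)) := by
  by_cases ha : a ∈ D.H
  · obtain ⟨b, hne, hb⟩ := D.paired a ha
    exact ⟨b, fun _ => ⟨hb, hne⟩, fun h => absurd ha h⟩
  · obtain ⟨b, hb⟩ := D.exists_diff_eq ha
    exact ⟨b, fun h => absurd h ha, fun _ => hb⟩

/-- The index of the other end of a homoclinic separatrix or of a transversal. -/
noncomputable def partner (a : ZMod N) : ZMod N := (D.exists_partner a).choose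

theorem rel_partner {a : ZMod N} (ha : a ∈ D.H) : D.rel a (D.partner a) :=
  ((D.exists_partner a).choose_spec.1 ha).1

theorem partner_ne {a : ZMod N} (ha : a ∈ D.H) : D.partner a ≠ a :=
  ((D.exists_partner a).choose_spec.1 ha).2

theorem diff_eq {Z : Set (ZMod N)} (hZ : IsCell D.rel Z) {a : ZMod N} (ha : a ∈ Z \ D.H) :
    Z \ D.H = {a, D.partner a} := by
  rw [hZ.eq_of_mem ha.1]
  exact ((D.exists_partner a).choose_spec.2 ha.2).1

theorem differentParity_partner {a : ZMod N} (hne : D.partner a ≠ a) :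
    DifferentParity a (D.partner a) := by
  by_cases ha : a ∈ D.H
  · exact (D.homoclinic a _ hne.symm (D.rel_partner ha) ha).2
  · exact ((D.exists_partner a).choose_spec.2 ha).2 hne

theorem eq_partner {a b : ZMod N} (ha : a ∈ D.H) (hab : D.rel a b) (hne : b ≠ a) :
    b = D.partner a :=
  D.isHomoclinicPairing.unique ha hab (D.rel_partner ha) hne (D.partner_ne ha)

theorem partner_mem_diff {Z : Set (ZMod N)} (hZ : IsCell D.rel Z) {a : ZMod N} (ha : a ∈ Z \ D.H) :
    D.partner a ∈ Z \ D.H := by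
  rw [D.diff_eq hZ ha]
  exact Or.inr rfl

theorem partner_notMem {a : ZMod N} (ha : a ∉ D.H) : D.partner a ∉ D.H :=
  (D.partner_mem_diff (isCell_of D.rel a) ⟨SameCell.refl _ a, ha⟩).2

theorem sameCell_partner {a : ZMod N} (ha : a ∉ D.H) : SameCell D.rel a (D.partner a) :=
  (D.partner_mem_diff (isCell_of D.rel a) ⟨SameCell.refl _ a, ha⟩).1

theorem partner_mem {a : ZMod N} (ha : a ∈ D.H) : D.partner a ∈ D.H :=
  (D.isHomoclinicPairing.mem_iff (D.rel_partner ha)).1 ha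

theorem partner_involutive : Function.Involutive D.partner := by
  intro a
  by_cases ha : a ∈ D.H
  · exact (D.eq_partner (D.partner_mem ha) (D.rel.symm (D.rel_partner ha))
      (D.partner_ne ha).symm).symm
  · by_cases hne : D.partner a = a
    · rw [hne, hne]
    · have hZ := isCell_of D.rel a
      have haZ : a ∈ {x | SameCell D.rel a x} \ D.H := ⟨SameCell.refl _ a, ha⟩
      have := D.diff_eq hZ (D.partner_mem_diff hZ haZ)
      rw [this] at haZ
      exact (haZ.resolve_left (Ne.symm hne)).symm

theorem val_ne_of_mem {a b : ZMod N} (ha : a ∈ D.H) (hb : b ∉ D.H) : a.val ≠ b.val :=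
  TransversalData.val_ne (by rintro rfl; exact hb ha)

theorem not_separates_of_mem_of_notMem {a b : ZMod N} (ha : a ∈ D.H) (hb : b ∉ D.H) :
    ¬ Separates a.val (D.partner a).val b.val (D.partner b).val := by
  intro hs
  apply D.sameCell_partner hb a _ (D.rel_partner ha)
  have h1 := D.val_ne_of_mem ha hb
  have h2 := D.val_ne_of_mem ha (D.partner_notMem hb)
  have h3 := D.val_ne_of_mem (D.partner_mem ha) hb
  have h4 := D.val_ne_of_mem (D.partner_mem ha) (D.partner_notMem hb)
  rw [separates_iff] at hs ⊢
  unfold sepPos endPos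
  omega

theorem nonCrossing_partner : NonCrossingInvolution D.partner := by
  intro a b hs
  by_cases ha : a ∈ D.H
  · by_cases hb : b ∈ D.H
    · have hab := D.nonCrossing a _ b _ (D.rel_partner ha) (D.rel_partner hb) hs
      have hne : b ≠ a := by
        rintro rfl
        rw [separates_iff] at hs
        omega
      obtain rfl := D.eq_partner ha hab hne
      rw [separates_iff] at hs
      omega
    · exact D.not_separates_of_mem_of_notMem ha hb hs
  · by_cases hb : b ∈ D.H
    · refine D.not_separates_of_mem_of_notMem hb ha (hs.swap ?_ ?_ ?_ ?_)
      · exact (D.val_ne_of_mem hb ha).symm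
      · exact (D.val_ne_of_mem (D.partner_mem hb) ha).symm
      · exact (D.val_ne_of_mem hb (D.partner_notMem ha)).symm
      · exact (D.val_ne_of_mem (D.partner_mem hb) (D.partner_notMem ha)).symm
    · by_cases hab : SameCell D.rel a b
      · have hbZ : b ∈ {x | SameCell D.rel a x} \ D.H := ⟨hab, hb⟩
        rw [D.diff_eq (isCell_of D.rel a) ⟨SameCell.refl _ a, ha⟩] at hbZ
        rw [separates_iff] at hs
        rcases hbZ with rfl | rfl
        · omega
        · omega
      -- An equivalent pair separates the two cells, and each transversal stays on its own side of
      -- it.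
      · unfold SameCell at hab
        push Not at hab
        obtain ⟨x, y, hxy, hs'⟩ := hab
        have h1 := D.sameCell_partner ha x y hxy
        have h2 := D.sameCell_partner hb x y hxy
        rw [separates_iff] at hs hs' h1 h2
        unfold sepPos endPos at *
        omega

/-- The transversal disk model that corresponds to a separatrix disk model. -/
noncomputable def toTransversalData : TransversalData N where
  ι := D.partner
  H := D.H
  T := {a | a ∉ D.H ∧ D.partner a ≠ a}
  involutive := D.partner_involutive
  parity _ h := D.differentParity_partner h
  nonCrossing := D.nonCrossing_partner
  marked a h := by
    by_cases ha : a ∈ D.H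
    · exact Or.inl ⟨ha, D.partner_mem ha⟩
    · refine Or.inr ⟨⟨ha, h⟩, D.partner_notMem ha, ?_⟩
      rw [D.partner_involutive a]
      exact h.symm
  paired a h := by
    rcases h with h | h
    exacts [D.partner_ne h, h.2]
  disjoint := Set.disjoint_left.2 fun _ ha h => h.1 ha

theorem sameTransversalCell_of_rel {a b : ZMod N} (ha : a ∉ D.H) (hab : D.rel a b) :
    SameTransversalCell D.toTransversalData a b := by
  constructor
  · intro x (hx : x ∈ D.H) hs
    change Separates _ (sepPos (D.partner x)) _ _ at hs
    rw [separates_sep_sep 0] at hs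
    have := D.nonCrossing.separates 0 (D.rel_partner hx) hab hs
    exact ha ((D.isHomoclinicPairing.mem_iff this).1 hx)
  · rintro x ⟨hx, -⟩ hs
    change Separates _ (endPos (D.partner x)) _ _ at hs
    refine D.sameCell_partner hx a b hab (Separates.swap hs ?_ ?_ ?_ ?_) <;>
      unfold sepPos endPos <;> omega

/-- If `a` and `b` are not equivalent, the cell facing `s_b` across the gap from `s_w` to `s_c` in
the class of `a` supplies a separating curve. It starts at the last end `e_z` of that cell before
`s_b`: a homoclinic separatrix if `z` is marked, the transversal to `e_c` otherwise. -/
theorem rel_of_sameTransversalCell {a b : ZMod N} (ha : a ∉ D.H) (hb : b ∉ D.H)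
    (hab : SameTransversalCell D.toTransversalData a b) : D.rel a b := by
  by_contra hnot
  have h := D.isHomoclinicPairing
  obtain ⟨c, w, hac, hcw, hwb⟩ := exists_isNext_not_mem hnot
  have hcH : c ∉ D.H := fun hc => ha ((h.mem_iff hac).2 hc)
  have hZ := isCell_of D.rel c
  have hw : SameCell D.rel c (w + 1) := hcw.sameCell h.nonCrossing
  have haw := hcw.2 a (D.rel.symm hac)
  have hbN := ZMod.val_lt (b - c)
  have hw1 := val_add_one_sub w c
  obtain ⟨z, ⟨hz, hzb⟩, hmax⟩ := Set.exists_max_image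
    {x | SameCell D.rel c x ∧ (x - c).val ≤ (b - c).val} (fun x => (x - c).val) (Set.toFinite _)
    ⟨w + 1, hw, by omega⟩
  have hzw := hmax (w + 1) ⟨hw, by omega⟩
  by_cases hzH : z ∈ D.H
  · have hnext := h.isNext hzH (D.rel_partner hzH) (D.partner_ne hzH)
    have hp1 := val_add_one_sub (D.partner z) c
    -- Were the partner of `z` before `b`, then either the next end of the cell would contradict the
    -- maximality of `z`, or the separatrix would run backwards and cut `e_z` off from `e_c`.
    have hpb : (b - c).val ≤ (D.partner z - c).val := by
      by_contra! hlt
      have h1 := hmax (D.partner z + 1) ⟨hz.trans (hnext.sameCell h.nonCrossing), by omega⟩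
      have h2 : (D.partner z - c).val ≠ (z - c).val := fun e => D.partner_ne hzH (val_sub_inj.1 e)
      have h3 := hz z (D.partner z) (D.rel_partner hzH)
      rw [separates_sep_end c, separates_iff] at h3
      simp only [sub_self, ZMod.val_zero] at h3
      omega
    have hbz : (b - c).val ≠ (z - c).val := fun e => hb (val_sub_inj.1 e ▸ hzH)
    have hbp : (b - c).val ≠ (D.partner z - c).val := fun e =>
      hb (val_sub_inj.1 e ▸ D.partner_mem hzH)
    apply hab.1 z hzH
    change Separates _ (sepPos (D.partner z)) _ _
    rw [separates_sep_sep c, separates_iff]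
    omega
  · have hzc : z ≠ c := by
      rw [← val_sub_pos]
      omega
    have hzZ : z ∈ {x | SameCell D.rel c x} \ D.H := ⟨hz, hzH⟩
    rw [D.diff_eq hZ ⟨SameCell.refl _ c, hcH⟩] at hzZ
    obtain rfl : z = D.partner c := hzZ.resolve_left hzc
    -- The point `s_a` lies between `s_c` and `s_w`, hence between the ends `e_c` and `e_z`, while
    -- `s_b` comes after `e_z`.
    apply hab.2 c ⟨hcH, hzc⟩
    change Separates _ (endPos (D.partner c)) _ _
    rw [separates_end_sep c, separates_iff]
    simp only [sub_self, ZMod.val_zero]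
    omega

theorem corresponds_toTransversalData : Corresponds D D.toTransversalData where
  marked_eq := rfl
  homoclinic_iff l hl m := by
    change D.partner l = m ↔ _
    constructor
    · rintro rfl
      exact ⟨D.rel_partner hl, D.partner_ne hl⟩
    · rintro ⟨h, hne⟩
      exact (D.eq_partner hl h hne).symm
  transversal_iff k j := by
    change ((k ∉ D.H ∧ D.partner k ≠ k) ∧ D.partner k = j) ↔ _
    have h := D.isHomoclinicPairing
    constructor
    · rintro ⟨⟨hk, hne⟩, rfl⟩
      have hZ := isCell_of D.rel k
      have hd := D.diff_eq hZ ⟨SameCell.refl _ k, hk⟩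
      have hcard := Set.ncard_pair hne.symm
      refine ⟨hne.symm, _, hZ, (D.cells _ hZ).resolve_right fun hc => ?_, hd⟩
      rw [← or_assoc] at hc
      rcases hc with hc | hc
      · obtain ⟨a, ha⟩ := h.diff_of_isSepalCell hZ hc
        rw [← hd, ha, Set.ncard_singleton] at hcard
        omega
      · rw [← hd, h.diff_of_isCenterCell hZ hc, Set.ncard_empty] at hcard
        omega
    · rintro ⟨hne, Z, hZ, -, hd⟩
      have hk : k ∈ Z \ D.H := by rw [hd]; exact Or.inl rfl
      have hj : j ∈ Z \ D.H := by rw [hd]; exact Or.inr rfl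
      rw [D.diff_eq hZ hk] at hj
      obtain rfl : j = D.partner k := hj.resolve_left hne.symm
      exact ⟨⟨hk.2, hne.symm⟩, rfl⟩
  unpaired_iff l := by
    change D.partner l = l ↔ _
    have h := D.isHomoclinicPairing
    constructor
    · intro hl
      have hlH : l ∉ D.H := fun h => D.partner_ne h hl
      have hZ := isCell_of D.rel l
      have hd := D.diff_eq hZ ⟨SameCell.refl _ l, hlH⟩
      rw [hl, Set.pair_eq_singleton] at hd
      refine ⟨_, hZ, ?_, hd⟩
      rcases D.cells _ hZ with hc | hc | hc | hc
      · obtain ⟨a, b, hao, hbe, hab⟩ := h.diff_of_isAlphaOmegaCell hZ hc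
        have ha : a ∈ ({l} : Set (ZMod N)) := by rw [← hd, hab]; exact Or.inl rfl
        have hb : b ∈ ({l} : Set (ZMod N)) := by rw [← hd, hab]; exact Or.inr rfl
        obtain rfl : a = l := ha
        obtain rfl : b = a := hb
        exact absurd hao hbe
      · exact Or.inl hc
      · exact Or.inr hc
      · exact absurd (hd.symm.trans (h.diff_of_isCenterCell hZ hc)) (Set.singleton_ne_empty l)
    · rintro ⟨Z, hZ, -, hd⟩
      have hl : l ∈ Z \ D.H := by rw [hd]; rfl
      rw [D.diff_eq hZ hl] at hd
      exact hd.subset (Or.inr rfl)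
  landing_iff _ _ hl hm :=
    ⟨D.sameTransversalCell_of_rel hl, D.rel_of_sameTransversalCell hl hm⟩

end SeparatrixData

/-! ### Uniqueness of the corresponding datum, and the bijection -/

theorem Corresponds.transversalData_eq {D : SeparatrixData N} {E E' : TransversalData N}
    (h : Corresponds D E) (h' : Corresponds D E') : E = E' := by
  have hH : E.H = E'.H := h.marked_eq.symm.trans h'.marked_eq
  have hT' : ∀ k j, (k ∈ E.T ∧ E.ι k = j) ↔ (k ∈ E'.T ∧ E'.ι k = j) := fun k j =>
    (h.transversal_iff k j).trans (h'.transversal_iff k j).symm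
  have hT : E.T = E'.T := Set.ext fun k =>
    ⟨fun hk => ((hT' k _).1 ⟨hk, rfl⟩).1, fun hk => ((hT' k _).2 ⟨hk, rfl⟩).1⟩
  have hι : E.ι = E'.ι := by
    funext l
    by_cases hl : E.ι l = l
    · rw [hl, ((h'.unpaired_iff l).2 ((h.unpaired_iff l).1 hl))]
    · rcases E.marked l hl with ⟨hm, -⟩ | ⟨hm, -⟩
      · rw [← h.marked_eq] at hm
        exact ((h'.homoclinic_iff l hm _).2 ((h.homoclinic_iff l hm _).1 rfl)).symm
      · exact ((hT' l _).1 ⟨hm, rfl⟩).2.symm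
  cases E
  cases E'
  simp only at hH hT hι
  subst hH hT hι
  rfl

theorem Corresponds.separatrixData_eq {D D' : SeparatrixData N} {E : TransversalData N}
    (h : Corresponds D E) (h' : Corresponds D' E) : D = D' := by
  have hH : D.H = D'.H := h.marked_eq.trans h'.marked_eq.symm
  have hr : D.rel = D'.rel := by
    ext a b
    by_cases hab : a = b
    · rw [hab]
      exact ⟨fun _ => D'.rel.refl b, fun _ => D.rel.refl b⟩
    by_cases ha : a ∈ D.H
    · have h1 := h.homoclinic_iff a ha b
      have h2 := h'.homoclinic_iff a (hH ▸ ha) b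
      have : b ≠ a := Ne.symm hab
      tauto
    by_cases hb : b ∈ D.H
    · have hb' : b ∈ D'.H := hH ▸ hb
      have ha' : a ∉ D'.H := hH ▸ ha
      have h1 := D.isHomoclinicPairing.mem_iff (a := a) (b := b)
      have h2 := D'.isHomoclinicPairing.mem_iff (a := a) (b := b)
      tauto
    · rw [h.landing_iff a b ha hb, h'.landing_iff a b (hH ▸ ha) (hH ▸ hb)]
  cases D
  cases D'
  simp only at hH hr
  subst hH hr
  rfl

/-- The equivalence of the two kinds of disk models. -/
noncomputable def separatrixDataEquiv (hN : Even N) : SeparatrixData N ≃ TransversalData N where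
  toFun D := D.toTransversalData
  invFun E := E.toSeparatrixData hN
  left_inv D := (TransversalData.corresponds_toSeparatrixData _ hN).separatrixData_eq
    D.corresponds_toTransversalData
  right_inv E := (SeparatrixData.corresponds_toTransversalData _).transversalData_eq
    (E.corresponds_toSeparatrixData hN)

theorem separatrixDataEquiv_eq_iff (hN : Even N) (D : SeparatrixData N) (E : TransversalData N) :
    separatrixDataEquiv hN D = E ↔ Corresponds D E :=
  ⟨fun h => h ▸ D.corresponds_toTransversalData,
    fun h => D.corresponds_toTransversalData.transversalData_eq h⟩

end DiskModel

theorem mainTheorem5 (d : ℕ) (hd : 2 ≤ d) :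
    ∃ Φ : DiskModel.SeparatrixData (2 * d - 2) ≃ DiskModel.TransversalData (2 * d - 2),
      ∀ (D : DiskModel.SeparatrixData (2 * d - 2)) (E : DiskModel.TransversalData (2 * d - 2)),
        Φ D = E ↔ DiskModel.Corresponds D E := by
  have : NeZero (2 * d - 2) := ⟨by omega⟩
  have hN : Even (2 * d - 2) := ⟨d - 1, by omega⟩
  exact ⟨DiskModel.separatrixDataEquiv hN, DiskModel.separatrixDataEquiv_eq_iff hN⟩
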